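/- Let $\mathbb{T}$ be the circle group (unimodular complex numbers), let $\mathbb{T}^{\infty}=\mathbb{T}^{\mathbb{N}}$ carry the product topology, and set $$\mathbb{T}_1^H=\Big\{(z_n)\in\mathbb{T}^{\infty} : \sum_{n}|1-z_n|<\infty\Big\},\qquad d\big((z_n),(w_n)\big)=\sum_{n}|z_n-w_n| .$$ For a topological abelian group $X$, let $X^{\wedge}$ be the group of continuous characters $X\to\mathbb{T}$ with the compact-open topology; $X$ is reflexive if the canonical homomorphism $X\to X^{\wedge\wedge}$, $x\mapsto(\chi\mapsto\chi(x))$, is a topological isomorphism. A subgroup $G$ of a Polish group $X$ is polishable if it is Borel and admits a Polish group topology for which the inclusion $G\to X$ is continuous. For a compact metrizable abelian group $X$ and a sequence $\mathbf{u}=(u_n)$ of continuous characters of $X$ put $s_{\mathbf{u}}(X)=\{x\in X: u_n(x)\to 1\}$. A subgroup $G$ of $X$ is characterized (basic $\mathfrak{g}$-closed) if $G=s_{\mathbf{u}}(X)$ for some $\mathbf{u}$, and $\mathfrak{g}$-closed if $G$ is the intersection of all subgroups $s_{\mathbf{u}}(X)$ that contain $G$. Then: 1. $\mathbb{T}_1^H$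 is a $\sigma$-compact polishable subgroup of $\mathbb{T}^{\infty}$ ($\sigma$-compact as a subset of $\mathbb{T}^{\infty}$). The topology defined by the metric $d$ is the unique Polish group topology on $\mathbb{T}_1^H$ for which the inclusion into $\mathbb{T}^{\infty}$ is continuous, and $\mathbb{T}_1^H$ with this topology is reflexive. 2. $\mathbb{T}_1^H$ is $\mathfrak{g}$-closed but not characterized (not basic $\mathfrak{g}$-closed) in $\mathbb{T}^{\infty}$. -/

import Mathlib

open Filter Topology

noncomputable section

/-! ### Pontryagin reflexivity -/

/-- The canonical homomorphism `α_X : X → X^^`, `x ↦ (χ ↦ χ x)`, where `X^` carries the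
compact-open topology. -/
def canonicalHom (X : Type*) [CommGroup X] [TopologicalSpace X] :
    X →* PontryaginDual (PontryaginDual X) where
  toFun x :=
    { toFun := fun χ : PontryaginDual X => χ x
      map_one' := rfl
      map_mul' := fun _ _ => rfl
      continuous_toFun :=
        ContinuousEvalConst.continuous_eval_const (F := X →ₜ* Circle) x }
  map_one' := PontryaginDual.ext fun χ => map_one χ
  map_mul' x y := PontryaginDual.ext fun χ => map_mul χ x y

theorem canonicalHom_apply {X : Type*} [CommGroup X] [TopologicalSpace X]
    (x : X) (χ : PontryaginDual X) : canonicalHom X x χ = χ x := rfl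

/-- `X` is (Pontryagin) reflexive: the canonical homomorphism into the bidual is a topological
isomorphism. -/
def IsReflexiveGroup (X : Type*) [CommGroup X] [TopologicalSpace X] : Prop :=
  IsHomeomorph (canonicalHom X)

/-! ### Polishable subgroups -/

/-- `τ` is a Polish group topology on the subgroup `G` of `X` making the inclusion into `X`
continuous. -/
def IsPolishGroupTopology {X : Type*} [Group X] [TopologicalSpace X] (G : Subgroup X)
    (τ : TopologicalSpace G) : Prop :=
  @PolishSpace G τ ∧ @IsTopologicalGroup G τ _ ∧
    @Continuous G X τ _ (fun g : G => (g : X))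

/-- A polishable subgroup: a Borel subgroup that carries a Polish group topology for which the
inclusion is continuous. -/
def IsPolishable {X : Type*} [Group X] [TopologicalSpace X] (G : Subgroup X) : Prop :=
  @MeasurableSet X (borel X) (G : Set X) ∧ ∃ τ : TopologicalSpace G, IsPolishGroupTopology G τ

/-! ### Characterized and `g`-closed subgroups -/

/-- `s_u(X)`, the subgroup of all `x` with `u_n(x) → 1`, for a sequence `u` of continuous
characters of `X`. -/
def charSubgroup {X : Type*} [CommGroup X] [TopologicalSpace X]
    (u : ℕ → PontryaginDual X) : Subgroup X where
  carrier := {x | Tendsto (fun n => u n x) atTop (𝓝 1)}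
  one_mem' := by simp
  mul_mem' {x y} hx hy := by simpa using Tendsto.mul hx hy
  inv_mem' {x} hx := by simpa using Tendsto.inv hx

/-- `G` is characterized (basic `g`-closed) in `X`: `G = s_u(X)` for some sequence `u`. -/
def IsCharacterized {X : Type*} [CommGroup X] [TopologicalSpace X] (G : Subgroup X) : Prop :=
  ∃ u : ℕ → PontryaginDual X, G = charSubgroup u

/-- The `g`-closure of `G` in `X`: the intersection of all `s_u(X)` that contain `G`. -/
def gClosure {X : Type*} [CommGroup X] [TopologicalSpace X] (G : Subgroup X) : Subgroup X :=
  ⨅ (u : ℕ → PontryaginDual X) (_ : G ≤ charSubgroup u), charSubgroup u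

/-- `G` is `g`-closed in `X`. -/
def IsGClosed {X : Type*} [CommGroup X] [TopologicalSpace X] (G : Subgroup X) : Prop :=
  G = gClosure G

/-! ### The group of sequences `(z_n)` with `∑ |1 - z_n| < ∞` -/

theorem norm_one_sub_mul_circle_le (z w : Circle) :
    ‖(1 : ℂ) - ((z * w : Circle) : ℂ)‖ ≤ ‖(1 : ℂ) - z‖ + ‖(1 : ℂ) - w‖ := by
  have h : (1 : ℂ) - ((z * w : Circle) : ℂ) = (1 - z) + z * (1 - w) := by
    push_cast; ring
  rw [h]
  refine (norm_add_le _ _).trans ?_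
  rw [norm_mul, Circle.norm_coe, one_mul]

theorem norm_one_sub_inv_circle (z : Circle) :
    ‖(1 : ℂ) - ((z⁻¹ : Circle) : ℂ)‖ = ‖(1 : ℂ) - z‖ := by
  have h : (1 : ℂ) - ((z⁻¹ : Circle) : ℂ) = ((z⁻¹ : Circle) : ℂ) * (z - 1) := by
    rw [mul_sub, ← Circle.coe_mul]; simp
  rw [h, norm_mul, Circle.norm_coe, one_mul, norm_sub_rev]

/-- The subgroup of `𝕋^∞` of all sequences `(z_n)` with `∑ |1 - z_n| < ∞`. -/
def TOneH : Subgroup (ℕ → Circle) where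
  carrier := {z | Summable fun n => ‖(1 : ℂ) - (z n : ℂ)‖}
  one_mem' := by simp
  mul_mem' {z w} hz hw :=
    Summable.of_nonneg_of_le (fun _ => norm_nonneg _)
      (fun n => norm_one_sub_mul_circle_le (z n) (w n)) (Summable.add hz hw)
  inv_mem' {z} hz := by
    simpa only [Set.mem_ofPred_eq, Pi.inv_apply, norm_one_sub_inv_circle] using hz

theorem TOneH.summable_norm_sub (z w : TOneH) :
    Summable fun n => ‖((z.1 n : Circle) : ℂ) - (w.1 n : ℂ)‖ := by
  have hz : Summable fun n => ‖(1 : ℂ) - (z.1 n : ℂ)‖ := z.2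
  have hw : Summable fun n => ‖(1 : ℂ) - (w.1 n : ℂ)‖ := w.2
  refine Summable.of_nonneg_of_le (fun _ => norm_nonneg _) (fun n => ?_) (hz.add hw)
  have h := norm_sub_le_norm_sub_add_norm_sub (z.1 n : ℂ) 1 (w.1 n : ℂ)
  rwa [norm_sub_rev (z.1 n : ℂ) 1] at h

/-- The metric `d(z, w) = ∑ |z_n - w_n|`. It is not an instance: the instance topology on the
subgroup is the one induced from `𝕋^∞`. -/
abbrev TOneH.metricSpace : MetricSpace TOneH where
  dist z w := ∑' n, ‖((z.1 n : Circle) : ℂ) - (w.1 n : ℂ)‖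
  dist_self z := by simp
  dist_comm z w := tsum_congr fun n => norm_sub_rev _ _
  dist_triangle x y z := by
    rw [← (TOneH.summable_norm_sub x y).tsum_add (TOneH.summable_norm_sub y z)]
    exact (TOneH.summable_norm_sub x z).tsum_le_tsum
      (fun n => norm_sub_le_norm_sub_add_norm_sub _ _ _)
      ((TOneH.summable_norm_sub x y).add (TOneH.summable_norm_sub y z))
  eq_of_dist_eq_zero {z w} h := by
    have h0 := (hasSum_zero_iff_of_nonneg (fun n => norm_nonneg _)).1
      (h ▸ (TOneH.summable_norm_sub z w).hasSum)
    refine Subtype.ext (funext fun n => Circle.ext ?_)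
    exact sub_eq_zero.1 (norm_eq_zero.1 (congrFun h0 n))

/-- The topology on the group defined by the metric `d`. -/
abbrev TOneH.metricTopology : TopologicalSpace TOneH :=
  TOneH.metricSpace.toPseudoMetricSpace.toUniformSpace.toTopologicalSpace

end

noncomputable section

/-! Everything rests on one estimate. Choose signs so that `x_n ^ (±1) = exp (i |arg x_n|)`. If all
products of these over subsets of a finite set `S` are within `δ ≤ 1` of `1`, then the angles, added
one at a time, never pass `π`; the total angle is at most `πδ/2`, and the sum of `|1 - x_n|` over
`S` is at most `2δ` (`sum_norm_one_sub_le`). So characters with exponents `0, ±1` detect absolute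
summability.

Topology: `d` is invariant, complete and separable, and its closed balls are compact in `𝕋^∞`.
Uniqueness of the Polish topology follows from the theorems of Pettis and Lusin–Souslin, applied to
the identity between two such topologies.

Reflexivity: the characters are `∏ z_n ^ k_n` with `k` bounded (`exists_eq_boundedChar`), and those
with `|k_n| ≤ M` form a compact set, a continuous image of a product of finite sets. For a character
`ψ` of the dual, continuity on the set with `M = 1` and the estimate make the values of `ψ` at the
coordinates an element of the group; finitely supported exponents being dense, `ψ` is evaluation
there. The same compact set recovers the `d`-neighbourhoods of `1`.

`g`-closed: if `x` is not in the group, the estimate fails on every tail. This yields characters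
supported on tails that stay away from `1` at `x` but tend to `1` on the group.

Not characterized: view the exponents of `u` as an integer matrix. Its rows and columns are finitely
supported and its entries are bounded (`exists_bound_exponents`). On a sparse set of columns meeting
each row at most once, every sequence tending to `1` is sent to `1` in the limit, summable or not.
-/

theorem continuous_circle_coe : Continuous fun z : Circle => (z : ℂ) := continuous_subtype_val

theorem circle_dist_eq_norm (z w : Circle) : dist z w = ‖(z : ℂ) - w‖ :=
  dist_eq_norm (z : ℂ) (w : ℂ)

/-! ### Signed products on the circle -/

theorem norm_one_sub_circleExp_le (t : ℝ) : ‖(1 : ℂ) - Circle.exp t‖ ≤ |t| := by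
  have := Real.norm_exp_I_mul_ofReal_sub_one_le (x := t)
  rwa [Circle.coe_exp, norm_sub_rev, mul_comm]

theorem two_div_pi_mul_le_norm_one_sub_circleExp {t : ℝ} (h0 : 0 ≤ t) (h : t ≤ Real.pi) :
    2 / Real.pi * t ≤ ‖(1 : ℂ) - Circle.exp t‖ := by
  rw [Circle.coe_exp, norm_sub_rev, mul_comm (t : ℂ), Complex.norm_exp_I_mul_ofReal_sub_one]
  have := Real.mul_le_sin (x := t / 2) (by linarith) (by linarith)
  refine le_trans ?_ (Real.le_norm_self _)
  linarith

/-- If all subset products of `exp (i t_j)` with `0 ≤ t_j ≤ π` are close to `1`, then the sum of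
the angles is small. -/
theorem sum_angle_le {ι : Type*} {t : ι → ℝ} (h0 : ∀ i, 0 ≤ t i) (hpi : ∀ i, t i ≤ Real.pi)
    {δ : ℝ} (hδ : δ ≤ 1) (S : Finset ι)
    (h : ∀ T ⊆ S, ‖(1 : ℂ) - Circle.exp (∑ i ∈ T, t i)‖ ≤ δ) :
    ∑ i ∈ S, t i ≤ Real.pi / 2 * δ := by
  classical
  have hp := Real.pi_pos
  have key : ∀ s : ℝ, 0 ≤ s → s ≤ Real.pi → ‖(1 : ℂ) - Circle.exp s‖ ≤ δ →
      s ≤ Real.pi / 2 * δ := by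
    intro s hs hs' hsδ
    have := (two_div_pi_mul_le_norm_one_sub_circleExp hs hs').trans hsδ
    calc s = Real.pi / 2 * (2 / Real.pi * s) := by field_simp
      _ ≤ _ := by gcongr
  induction S using Finset.induction_on with
  | empty =>
    have := (norm_nonneg _).trans (h ∅ subset_rfl)
    simp only [Finset.sum_empty]
    positivity
  | insert a S ha ih =>
    have h1 := ih fun T hT => h T (hT.trans (Finset.subset_insert _ _))
    have h2 := key (t a) (h0 a) (hpi a) (by simpa using h {a} (by simp))
    -- The old sum and the new angle are each at most `π/2`, so the new sum is still in `[0, π]`,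
    -- where `key` turns the chord bound into an angle bound without accumulating constants.
    refine key _ (Finset.sum_nonneg fun i _ => h0 i) ?_ (h _ subset_rfl)
    rw [Finset.sum_insert ha]
    nlinarith

/-- The sign of the argument of `z`, so that `z ^ circleSign z = exp (i |arg z|)`. -/
def circleSign (z : Circle) : ℤ := if 0 ≤ Complex.arg z then 1 else -1

theorem abs_circleSign (z : Circle) : |circleSign z| = 1 := by
  unfold circleSign; split_ifs <;> simp

theorem zpow_circleSign (z : Circle) : z ^ circleSign z = Circle.exp |Complex.arg z| := by
  unfold circleSign
  split_ifs with h
  · rw [abs_of_nonneg h, Circle.exp_arg, zpow_one]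
  · rw [abs_of_neg (not_le.1 h), Circle.exp_neg, Circle.exp_arg, zpow_neg, zpow_one]

theorem circleExp_sum {ι : Type*} (t : ι → ℝ) (S : Finset ι) :
    Circle.exp (∑ i ∈ S, t i) = ∏ i ∈ S, Circle.exp (t i) := by
  classical
  induction S using Finset.induction_on with
  | empty => simp
  | insert a S ha ih => rw [Finset.sum_insert ha, Finset.prod_insert ha, Circle.exp_add, ih]

theorem sum_norm_one_sub_le {ι : Type*} {x : ι → Circle} {δ : ℝ} (hδ : δ ≤ 1) (S : Finset ι)
    (h : ∀ T ⊆ S, ‖(1 : ℂ) - (∏ i ∈ T, x i ^ circleSign (x i) : Circle)‖ ≤ δ) :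
    ∑ i ∈ S, ‖(1 : ℂ) - x i‖ ≤ 2 * δ := by
  have hδ0 : 0 ≤ δ := (norm_nonneg _).trans (h ∅ (by simp))
  have h1 := sum_angle_le (t := fun i => |Complex.arg (x i)|) (fun i => abs_nonneg _)
    (fun i => Complex.abs_arg_le_pi _) hδ S fun T hT => by
      rw [circleExp_sum]
      simpa only [zpow_circleSign] using h T hT
  calc ∑ i ∈ S, ‖(1 : ℂ) - x i‖ ≤ ∑ i ∈ S, |Complex.arg (x i)| :=
        Finset.sum_le_sum fun i _ => by
          simpa only [Circle.exp_arg] using norm_one_sub_circleExp_le (Complex.arg (x i))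
    _ ≤ Real.pi / 2 * δ := h1
    _ ≤ 2 * δ := by have := Real.pi_le_four; gcongr; linarith

/-- If all finite signed products away from a finite set are close to `1`, then
`∑ |1 - x_n|` converges. -/
theorem summable_norm_one_sub_of_prod_le {x : ℕ → Circle} (I : Finset ℕ)
    (h : ∀ T, Disjoint T I → ‖(1 : ℂ) - (∏ n ∈ T, x n ^ circleSign (x n) : Circle)‖ ≤ 1) :
    Summable fun n => ‖(1 : ℂ) - x n‖ := by
  refine summable_of_sum_le (c := ∑ n ∈ I, ‖(1 : ℂ) - x n‖ + 2) (fun _ => norm_nonneg _)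
    fun S => ?_
  have hS : ∑ n ∈ S \ I, ‖(1 : ℂ) - x n‖ ≤ 2 * 1 :=
    sum_norm_one_sub_le le_rfl _ fun T hT => h T (Finset.disjoint_of_subset_left hT
      Finset.sdiff_disjoint)
  calc ∑ n ∈ S, ‖(1 : ℂ) - x n‖
      = ∑ n ∈ S ∩ I, ‖(1 : ℂ) - x n‖ + ∑ n ∈ S \ I, ‖(1 : ℂ) - x n‖ :=
        (Finset.sum_inter_add_sum_sdiff _ _ _).symm
    _ ≤ _ := add_le_add (Finset.sum_le_sum_of_subset_of_nonneg Finset.inter_subset_right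
        fun _ _ _ => norm_nonneg _) (by linarith)

/-- The circle has no small subgroups: the estimate for `n` copies of `z`, whose signed products are
powers of `z`, gives `n |1 - z| ≤ 2` for all `n`. -/
theorem circle_eq_one_of_zpow {z : Circle} (h : ∀ m : ℤ, ‖(1 : ℂ) - (z ^ m : Circle)‖ ≤ 1) :
    z = 1 := by
  have key : ∀ n : ℕ, (n : ℝ) * ‖(1 : ℂ) - z‖ ≤ 2 := by
    intro n
    have := sum_norm_one_sub_le (x := fun _ : ℕ => z) le_rfl (Finset.range n) fun T _ => by
      rw [Finset.prod_const, ← zpow_natCast, ← zpow_mul]; exact h _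
    simpa using this
  by_contra hz
  have hpos : 0 < ‖(1 : ℂ) - z‖ := by
    rw [norm_pos_iff, sub_ne_zero]
    exact fun h => hz (Circle.ext h.symm)
  obtain ⟨n, hn⟩ := exists_nat_gt (2 / ‖(1 : ℂ) - z‖)
  rw [div_lt_iff₀ hpos] at hn
  exact absurd (key n) (not_le.2 hn)

theorem norm_one_sub_circle_zpow_le (z : Circle) (k : ℤ) :
    ‖(1 : ℂ) - (z ^ k : Circle)‖ ≤ |(k : ℝ)| * ‖(1 : ℂ) - z‖ := by
  have hnat : ∀ n : ℕ, ‖(1 : ℂ) - (z ^ n : Circle)‖ ≤ n * ‖(1 : ℂ) - z‖ := by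
    intro n
    induction n with
    | zero => simp
    | succ n ih =>
      rw [pow_succ]
      refine (norm_one_sub_mul_circle_le _ _).trans ?_
      push_cast at ih ⊢
      linarith
  obtain ⟨n, rfl | rfl⟩ := k.eq_nat_or_neg
  · simpa using hnat n
  · rw [zpow_neg, norm_one_sub_inv_circle]; simpa using hnat n

/-! ### Characters of the circle -/

/-- A continuous endomorphism of the circle is `z ↦ z ^ k`. -/
theorem exists_zpow_of_continuous_circleHom (f : Circle →* Circle) (hf : Continuous f) :
    ∃ k : ℤ, ∀ z, f z = z ^ k := by
  have : Fact (0 < 2 * Real.pi) := ⟨Real.two_pi_pos⟩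
  let g : C(AddCircle (2 * Real.pi), ℂ) :=
    ⟨fun x => f (AddCircle.toCircle x),
      continuous_circle_coe.comp (hf.comp AddCircle.continuous_toCircle)⟩
  have hg : ∀ x y, g (x + y) = g x * g y := by
    intro x y
    simp [g, AddCircle.toCircle_add]
  -- If all Fourier coefficients vanished, the Fourier series would give `g = 0`, against `g 0 = 1`.
  have hne : ∃ n, fourierCoeff g n ≠ 0 := by
    by_contra! hall
    have h := hasSum_fourier_series_of_summable (f := g) (by
      rw [show fourierCoeff g = fun _ => 0 from funext hall]; exact summable_zero)
    simp only [hall, zero_smul] at h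
    have h0 : g = 0 := h.unique hasSum_zero
    have h1 : g 0 = 1 := by simp [g]
    rw [h0] at h1
    simp at h1
  obtain ⟨n, hn⟩ := hne
  -- Translation by `a` multiplies the integral defining the `n`-th coefficient by `fourier (-n) a *
  -- g a`; invariance of Haar measure and `hn` force this factor to be `1`.
  have htr : ∀ a, fourier (-n) a * g a = 1 := by
    intro a
    have h := MeasureTheory.integral_add_right_eq_self (μ := AddCircle.haarAddCircle)
      (fun t : AddCircle (2 * Real.pi) => fourier (-n) t • g t) a
    have h2 : ∀ t : AddCircle (2 * Real.pi), fourier (-n) (t + a) • g (t + a) =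
        (fourier (-n) a * g a) * (fourier (-n) t • g t) := by
      intro t
      have : (fourier (-n) (t + a) : ℂ) = fourier (-n) t * fourier (-n) a := by
        simp only [fourier_apply, zsmul_add, AddCircle.toCircle_add, Circle.coe_mul]
      rw [this, hg, smul_eq_mul, smul_eq_mul]; ring
    simp only [h2] at h
    rw [MeasureTheory.integral_const_mul] at h
    exact mul_right_cancel₀ hn (h.trans (one_mul _).symm)
  refine ⟨n, fun z => ?_⟩
  obtain ⟨x, rfl⟩ : ∃ x : AddCircle (2 * Real.pi), AddCircle.toCircle x = z :=
    ((AddCircle.homeomorphCircle Real.two_pi_pos.ne').surjective z).imp fun x hx => by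
      rwa [AddCircle.homeomorphCircle_apply] at hx
  have h := htr x
  rw [fourier_apply, AddCircle.toCircle_zsmul] at h
  have h' : (AddCircle.toCircle x ^ (-n) : Circle) * f (AddCircle.toCircle x) = 1 :=
    Circle.ext h
  rw [zpow_neg] at h'
  exact (inv_mul_eq_one.1 h').symm

/-- If `z ^ a_j → 1` for all unimodular `z`, then `a_j = 0` for all large `j`. -/
theorem eventually_eq_zero_of_tendsto_zpow {a : ℕ → ℤ}
    (h : ∀ z : Circle, Tendsto (fun j => z ^ a j) atTop (𝓝 1)) : ∀ᶠ j in atTop, a j = 0 := by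
  -- The integral of `z ^ a j` over the circle tends to `2π` by dominated convergence, yet it is `0`
  -- whenever `a j ≠ 0`.
  have hlim : Tendsto (fun j => ∫ t in (0 : ℝ)..2 * Real.pi, ((Circle.exp t ^ a j : Circle) : ℂ))
      atTop (𝓝 (∫ t in (0 : ℝ)..2 * Real.pi, (1 : ℂ))) := by
    refine intervalIntegral.tendsto_integral_filter_of_dominated_convergence (fun _ => 1)
      (Eventually.of_forall fun j => ?_) (Eventually.of_forall fun j => ?_)
      intervalIntegrable_const ?_
    · exact (continuous_circle_coe.comp
        ((continuous_zpow (a j)).comp Circle.exp.continuous)).aestronglyMeasurable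
    · exact MeasureTheory.ae_of_all _ fun t _ => (Circle.norm_coe _).le
    · exact MeasureTheory.ae_of_all _ fun t _ =>
        (continuous_circle_coe.tendsto 1).comp (h (Circle.exp t))
  have hne : (∫ t in (0 : ℝ)..2 * Real.pi, (1 : ℂ)) ≠ 0 := by
    simp [Real.pi_ne_zero]
  filter_upwards [hlim.eventually_ne hne] with j hj
  by_contra ha
  refine hj ?_
  have hI : (a j : ℂ) * Complex.I ≠ 0 := by simp [ha]
  have : ∀ t : ℝ, ((Circle.exp t ^ a j : Circle) : ℂ) = Complex.exp (a j * Complex.I * t) := by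
    intro t
    rw [← Circle.exp_zsmul, Circle.coe_exp]
    congr 1
    push_cast [zsmul_eq_mul]
    ring
  simp only [this]
  rw [integral_exp_mul_complex hI]
  have h2 : Complex.exp (a j * Complex.I * ((2 * Real.pi : ℝ) : ℂ)) = 1 := by
    rw [Complex.exp_eq_one_iff]
    exact ⟨a j, by push_cast; ring⟩
  rw [h2]; simp

/-! ### The metric group is Polish -/

/-- The group `TOneH` with the topology of the metric `d`. -/
def MetricTOneH : Type := TOneH

namespace MetricTOneH

instance : CommGroup MetricTOneH := inferInstanceAs (CommGroup TOneH)
instance : MetricSpace MetricTOneH := TOneH.metricSpace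

instance : FunLike MetricTOneH ℕ Circle where
  coe z := (show TOneH from z).1
  coe_injective := Subtype.val_injective

/-- The element of `MetricTOneH` with the given coordinates. -/
def mk (x : ℕ → Circle) (hx : Summable fun n => ‖(1 : ℂ) - x n‖) : MetricTOneH := (⟨x, hx⟩ : TOneH)

@[simp] theorem mk_apply (x : ℕ → Circle) (hx) (n : ℕ) : mk x hx n = x n := rfl
@[simp] theorem one_apply (n : ℕ) : (1 : MetricTOneH) n = 1 := rfl
@[simp] theorem mul_apply (z w : MetricTOneH) (n : ℕ) : (z * w) n = z n * w n := rfl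

theorem summable (z : MetricTOneH) : Summable fun n => ‖(1 : ℂ) - z n‖ := (show TOneH from z).2

theorem summable_sub (z w : MetricTOneH) : Summable fun n => ‖(z n : ℂ) - w n‖ :=
  TOneH.summable_norm_sub z w

theorem dist_def (z w : MetricTOneH) : dist z w = ∑' n, ‖(z n : ℂ) - w n‖ := rfl

theorem norm_sub_le_dist (z w : MetricTOneH) (n : ℕ) : ‖(z n : ℂ) - w n‖ ≤ dist z w :=
  (summable_sub z w).le_tsum n fun _ _ => norm_nonneg _

theorem dist_apply_le (z w : MetricTOneH) (n : ℕ) : dist (z n) (w n) ≤ dist z w :=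
  (circle_dist_eq_norm _ _).trans_le (norm_sub_le_dist z w n)

theorem dist_le_of_sum_le {z w : MetricTOneH} {r : ℝ}
    (h : ∀ N, ∑ n ∈ Finset.range N, ‖(z n : ℂ) - w n‖ ≤ r) : dist z w ≤ r :=
  Real.tsum_le_of_sum_range_le (fun _ => norm_nonneg _) h

theorem continuous_apply (n : ℕ) : Continuous fun z : MetricTOneH => z n :=
  (LipschitzWith.of_dist_le_mul (K := 1) fun z w => by
    simpa using dist_apply_le z w n).continuous

theorem continuous_coe : Continuous fun z : MetricTOneH => (z : ℕ → Circle) :=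
  continuous_pi continuous_apply

instance : IsIsometricSMul MetricTOneH MetricTOneH :=
  ⟨fun a => Isometry.of_dist_eq fun z w => tsum_congr fun n => by
    change ‖((a n * z n : Circle) : ℂ) - ((a n * w n : Circle) : ℂ)‖ = ‖(z n : ℂ) - w n‖
    rw [Circle.coe_mul, Circle.coe_mul, ← mul_sub, norm_mul, Circle.norm_coe, one_mul]⟩

instance : IsTopologicalGroup MetricTOneH where
  continuous_mul := by
    refine (LipschitzWith.of_dist_le_mul (K := 2) fun p q => ?_).continuous
    calc dist (p.1 * p.2) (q.1 * q.2)
        ≤ dist (p.1 * p.2) (p.1 * q.2) + dist (p.1 * q.2) (q.1 * q.2) := dist_triangle _ _ _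
      _ = dist p.2 q.2 + dist p.1 q.1 := by
        rw [dist_mul_left, mul_comm p.1, mul_comm q.1, dist_mul_left]
      _ ≤ dist p q + dist p q :=
        add_le_add ((le_max_right _ _).trans_eq Prod.dist_eq.symm)
          ((le_max_left _ _).trans_eq Prod.dist_eq.symm)
      _ = (2 : NNReal) * dist p q := by push_cast; ring
  continuous_inv := by
    refine (Isometry.of_dist_eq fun z w => ?_).continuous
    rw [← dist_mul_left (z * w), dist_comm]
    congr 1
    · exact mul_inv_cancel_right _ _
    · exact mul_inv_cancel_comm _ _

/-- The truncation `(x_0, …, x_{N-1}, 1, 1, …)`. -/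
def trunc (N : ℕ) : (ℕ → Circle) →* MetricTOneH where
  toFun x := mk (fun n => if n < N then x n else 1) <|
    summable_of_ne_finset_zero (s := Finset.range N) fun n hn => by
      simp only [Finset.mem_range] at hn; simp [hn]
  map_one' := DFunLike.ext _ _ fun n => by simp
  map_mul' x y := DFunLike.ext _ _ fun n => by by_cases h : n < N <;> simp [h]

@[simp] theorem trunc_apply (N : ℕ) (x : ℕ → Circle) (n : ℕ) :
    trunc N x n = if n < N then x n else 1 := rfl

theorem dist_trunc_trunc (N : ℕ) (x y : ℕ → Circle) :
    dist (trunc N x) (trunc N y) = ∑ n ∈ Finset.range N, ‖(x n : ℂ) - y n‖ := by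
  rw [dist_def, tsum_eq_sum (s := Finset.range N)]
  · refine Finset.sum_congr rfl fun n hn => ?_
    rw [Finset.mem_range] at hn
    simp [hn]
  · intro n hn
    rw [Finset.mem_range] at hn
    simp [hn]

theorem continuous_trunc (N : ℕ) : Continuous (trunc N) := by
  refine continuous_iff_continuousAt.2 fun x => tendsto_iff_dist_tendsto_zero.2 ?_
  simp only [dist_trunc_trunc]
  have : Continuous fun y : ℕ → Circle => ∑ n ∈ Finset.range N, ‖(y n : ℂ) - x n‖ :=
    continuous_finsetSum _ fun n _ =>
      ((continuous_circle_coe.comp (_root_.continuous_apply n)).sub continuous_const).norm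
  simpa using this.tendsto x

theorem tendsto_trunc (z : MetricTOneH) : Tendsto (fun N => trunc N z) atTop (𝓝 z) := by
  rw [tendsto_iff_dist_tendsto_zero]
  have h := tendsto_sum_nat_add fun n => ‖(1 : ℂ) - z n‖
  refine h.congr fun N => ?_
  rw [dist_def, ← (summable_sub (trunc N z) z).sum_add_tsum_nat_add N, Finset.sum_eq_zero, zero_add]
  · simp
  · intro n hn
    rw [Finset.mem_range] at hn
    simp [hn]

/-- The element with `n`-th coordinate `w` and all others `1`. -/
def single (n : ℕ) : Circle →* MetricTOneH where
  toFun w := mk (Pi.mulSingle n w) <|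
    summable_of_ne_finset_zero (s := {n}) fun m hm => by
      rw [Finset.mem_singleton] at hm; simp [hm]
  map_one' := DFunLike.ext _ _ fun m => by simp
  map_mul' x y := DFunLike.ext _ _ fun m => by simp [Pi.mulSingle_mul]

@[simp] theorem single_apply (n : ℕ) (w : Circle) (m : ℕ) :
    single n w m = (Pi.mulSingle n w : ℕ → Circle) m := rfl

theorem dist_single (n : ℕ) (w w' : Circle) :
    dist (single n w) (single n w') = ‖(w : ℂ) - w'‖ := by
  rw [dist_def, tsum_eq_single n]
  · simp
  · intro m hm; simp [hm]

theorem continuous_single (n : ℕ) : Continuous (single n) :=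
  (Isometry.of_dist_eq fun w w' =>
    (dist_single n w w').trans (circle_dist_eq_norm w w').symm).continuous

theorem trunc_eq_prod (N : ℕ) (x : ℕ → Circle) :
    trunc N x = ∏ n ∈ Finset.range N, single n (x n) := by
  induction N with
  | zero => exact DFunLike.ext _ _ fun n => by simp
  | succ N ih =>
    rw [Finset.prod_range_succ, ← ih]
    refine DFunLike.ext _ _ fun n => ?_
    rcases lt_trichotomy n N with h | rfl | h
    · simp [h, h.ne, h.trans N.lt_succ_self]
    · simp
    · simp [h.not_gt, h.ne', h.not_ge]

/-- A closed `d`-ball, cut out by conditions on finitely many coordinates each. It serves both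
completeness, through coordinatewise limits, and σ-compactness. -/
theorem isClosed_coe_closedBall (z : MetricTOneH) (r : ℝ) :
    IsClosed {x : ℕ → Circle | ∀ N, ∑ n ∈ Finset.range N, ‖(z n : ℂ) - x n‖ ≤ r} := by
  simp only [Set.ofPred_forall]
  exact isClosed_iInter fun N => isClosed_le (continuous_finsetSum _ fun n _ =>
    (continuous_const.sub (continuous_circle_coe.comp (_root_.continuous_apply n))).norm)
    continuous_const

theorem summable_of_sum_le {z : MetricTOneH} {x : ℕ → Circle} {r : ℝ}
    (h : ∀ N, ∑ n ∈ Finset.range N, ‖(z n : ℂ) - x n‖ ≤ r) :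
    Summable fun n => ‖(1 : ℂ) - x n‖ := by
  refine Summable.of_nonneg_of_le (fun _ => norm_nonneg _) (fun n => ?_)
    (z.summable.add (summable_of_sum_range_le (fun _ => norm_nonneg _) h))
  exact norm_sub_le_norm_sub_add_norm_sub _ _ _

theorem sum_le_dist (z w : MetricTOneH) (N : ℕ) :
    ∑ n ∈ Finset.range N, ‖(z n : ℂ) - w n‖ ≤ dist z w :=
  (summable_sub z w).sum_le_tsum _ fun _ _ => norm_nonneg _

instance : CompleteSpace MetricTOneH := by
  refine Metric.complete_of_cauchySeq_tendsto fun u hu => ?_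
  have hlim : ∀ n, ∃ w : Circle, Tendsto (fun k => u k n) atTop (𝓝 w) := fun n =>
    cauchySeq_tendsto_of_complete (Metric.cauchySeq_iff.2 fun ε hε =>
      (Metric.cauchySeq_iff.1 hu ε hε).imp fun K hK m hm k hk =>
        (dist_apply_le _ _ n).trans_lt (hK m hm k hk))
  choose x hx using hlim
  have key : ∀ ε > 0, ∃ K, ∀ k ≥ K, ∀ N, ∑ n ∈ Finset.range N, ‖(u k n : ℂ) - x n‖ ≤ ε := by
    intro ε hε
    obtain ⟨K, hK⟩ := Metric.cauchySeq_iff.1 hu ε hε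
    refine ⟨K, fun k hk => ?_⟩
    refine (isClosed_coe_closedBall (u k) ε).mem_of_tendsto (tendsto_pi_nhds.2 hx)
      (eventually_atTop.2 ⟨K, fun l hl N => ?_⟩)
    exact (sum_le_dist _ _ N).trans (hK k hk l hl).le
  obtain ⟨K, hK⟩ := key 1 one_pos
  refine ⟨mk x (summable_of_sum_le (hK K le_rfl)), Metric.tendsto_atTop'.2 fun ε hε => ?_⟩
  obtain ⟨K, hK⟩ := key (ε / 2) (half_pos hε)
  exact ⟨K, fun k hk => (dist_le_of_sum_le (hK k hk.le)).trans_lt (half_lt_self hε)⟩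

instance : TopologicalSpace.SeparableSpace MetricTOneH := by
  rw [← TopologicalSpace.isSeparable_univ_iff]
  have h : TopologicalSpace.IsSeparable (⋃ N, Set.range (trunc N)) :=
    TopologicalSpace.IsSeparable.iUnion fun N =>
      TopologicalSpace.isSeparable_range (continuous_trunc N)
  refine h.closure.mono fun z _ => mem_closure_of_tendsto (tendsto_trunc z)
    (Eventually.of_forall fun N => Set.mem_iUnion.2 ⟨N, z, rfl⟩)

instance : SecondCountableTopology MetricTOneH :=
  UniformSpace.secondCountable_of_separable _

end MetricTOneH

/-! ### σ-compactness and Borel measurability -/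

theorem coe_TOneH_eq_iUnion : (TOneH : Set (ℕ → Circle)) =
    ⋃ k : ℕ, {x | ∀ N, ∑ n ∈ Finset.range N, ‖((1 : MetricTOneH) n : ℂ) - x n‖ ≤ k} := by
  ext x
  simp only [Set.mem_iUnion]
  constructor
  · intro hx
    obtain ⟨k, hk⟩ := exists_nat_ge (dist 1 (MetricTOneH.mk x hx))
    exact ⟨k, fun N => (MetricTOneH.sum_le_dist 1 (MetricTOneH.mk x hx) N).trans hk⟩
  · rintro ⟨k, hk⟩
    exact MetricTOneH.summable_of_sum_le hk

theorem isSigmaCompact_TOneH : IsSigmaCompact (TOneH : Set (ℕ → Circle)) := by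
  rw [coe_TOneH_eq_iUnion]
  exact isSigmaCompact_iUnion_of_isCompact _ fun k =>
    (MetricTOneH.isClosed_coe_closedBall 1 k).isCompact

theorem measurableSet_TOneH : @MeasurableSet _ (borel (ℕ → Circle)) (TOneH : Set (ℕ → Circle)) := by
  borelize (ℕ → Circle)
  rw [coe_TOneH_eq_iUnion]
  exact MeasurableSet.iUnion fun k => (MetricTOneH.isClosed_coe_closedBall 1 k).measurableSet

theorem isPolishGroupTopology_metricTopology :
    IsPolishGroupTopology TOneH TOneH.metricTopology :=
  ⟨inferInstanceAs (PolishSpace MetricTOneH), inferInstanceAs (IsTopologicalGroup MetricTOneH),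
    MetricTOneH.continuous_coe⟩

/-! ### Automatic continuity and uniqueness of the topology -/

/-- Pettis: a homomorphism from a Baire topological group to a separable topological group is
continuous if preimages of open sets have the property of Baire. -/
theorem MonoidHom.continuous_of_baireMeasurableSet_preimage {G H : Type*} [Group G]
    [TopologicalSpace G] [IsTopologicalGroup G] [BaireSpace G] [Group H] [TopologicalSpace H]
    [IsTopologicalGroup H] [TopologicalSpace.SeparableSpace H] (f : G →* H)
    (hf : ∀ U : Set H, IsOpen U → BaireMeasurableSet (f ⁻¹' U)) : Continuous f := by
  refine continuous_of_tendsto_nhds_one f fun V hV => ?_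
  obtain ⟨W, hWo, hW1, hWV⟩ : ∃ W : Set H, IsOpen W ∧ (1 : H) ∈ W ∧
      ∀ a ∈ W, ∀ b ∈ W, a * b⁻¹ ∈ V := by
    have : Tendsto (fun p : H × H => p.1 * p.2⁻¹) (𝓝 (1, 1)) (𝓝 1) := by
      have : Continuous fun p : H × H => p.1 * p.2⁻¹ := by fun_prop
      simpa using this.tendsto (1, 1)
    rw [nhds_prod_eq] at this
    obtain ⟨W₀, hW, hWV⟩ := mem_prod_same_iff.1 (this hV)
    obtain ⟨W', hW', ho, h1⟩ := mem_nhds_iff.1 hW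
    exact ⟨W', ho, h1, fun a ha b hb => hWV (show (a, b) ∈ W₀ ×ˢ W₀ from ⟨hW' ha, hW' hb⟩)⟩
  obtain ⟨D, hDc, hDd⟩ := TopologicalSpace.exists_countable_dense H
  let A : H → Set G := fun d => f ⁻¹' ((fun y => y * d⁻¹) ⁻¹' W)
  have hAo : ∀ d, BaireMeasurableSet (A d) := fun d =>
    hf _ (hWo.preimage (continuous_mul_const _))
  have hcover : ⋃ d ∈ D, A d = Set.univ := by
    refine Set.eq_univ_of_forall fun g => ?_
    obtain ⟨d, hd, hdD⟩ := hDd.inter_open_nonempty ((fun d => f g * d⁻¹) ⁻¹' W)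
      (hWo.preimage (by fun_prop)) ⟨f g, by simpa using hW1⟩
    exact Set.mem_biUnion hdD hd
  -- Countably many sets `A d` cover the Baire space `G`, so one is not meagre; it agrees with a
  -- nonempty open `U` up to a meagre set.
  obtain ⟨d, -, hd⟩ : ∃ d ∈ D, ¬ IsMeagre (A d) := by
    by_contra! hall
    refine not_isMeagre_of_isOpen (isOpen_univ (X := G)) Set.univ_nonempty ?_
    rw [← hcover]
    exact isMeagre_biUnion hDc hall
  obtain ⟨U, hUo, hU⟩ := (hAo d).residualEq_isOpen
  rw [eventuallyEq_set] at hU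
  obtain ⟨u, hu⟩ : U.Nonempty := by
    by_contra hne
    rw [Set.not_nonempty_iff_eq_empty] at hne
    subst hne
    exact hd (mem_of_superset hU fun x hx hxA => hx.1 hxA)
  have hnhds : (fun g => g * u) ⁻¹' U ∈ 𝓝 (1 : G) :=
    (hUo.preimage (continuous_mul_const u)).mem_nhds (by simpa using hu)
  rw [mem_map]
  filter_upwards [hnhds] with g hg
  have hU' : ∀ᶠ x in residual G, g * x ∈ A d ↔ g * x ∈ U :=
    (tendsto_residual_of_isOpenMap (continuous_const_mul g) (isOpenMap_mul_left g)).eventually hU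
  -- For `g` near `1` the open set `U ∩ g⁻¹U` is nonempty, so it contains a generic `x` with both
  -- `x` and `g * x` in `A d`; then `f g = f (g * x) * (f x)⁻¹` lies in `V`.
  obtain ⟨x, ⟨hx1, hx2⟩, hx3, hx4⟩ := (dense_of_mem_residual (hU.and hU')).inter_open_nonempty
    (U ∩ (fun x => g * x) ⁻¹' U) (hUo.inter (hUo.preimage (continuous_const_mul g))) ⟨u, hu, hg⟩
  have := hWV _ (hx4.2 hx2) _ (hx3.2 hx1)
  simpa using this

/-- A homomorphism between Polish groups is continuous if it becomes so after composition with an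
injective continuous map into a Hausdorff space. -/
theorem MonoidHom.continuous_of_comp_injective {G H X : Type*} [Group G] [TopologicalSpace G]
    [IsTopologicalGroup G] [PolishSpace G] [Group H] [TopologicalSpace H]
    [IsTopologicalGroup H] [PolishSpace H] [TopologicalSpace X] [T2Space X] (f : G →* H)
    {j : H → X} (hj : Continuous j) (hinj : Function.Injective j) (hjf : Continuous (j ∘ f)) :
    Continuous f := by
  borelize G H X
  refine f.continuous_of_baireMeasurableSet_preimage fun U hU => ?_
  -- Lusin–Souslin: the injective continuous image `j '' U` is Borel, and `f ⁻¹' U` is its preimage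
  -- under `j ∘ f`.
  have h := (hU.measurableSet.image_of_continuousOn_injOn hj.continuousOn hinj.injOn)
  have h2 := (hjf.measurable h).baireMeasurableSet
  rwa [Set.preimage_comp, Set.preimage_image_eq _ hinj] at h2

theorem IsPolishGroupTopology.le {X : Type*} [Group X] [TopologicalSpace X] [T2Space X]
    {G : Subgroup X} {τ τ' : TopologicalSpace G} (h : IsPolishGroupTopology G τ)
    (h' : IsPolishGroupTopology G τ') : τ ≤ τ' := by
  obtain ⟨h1, h2, h3⟩ := h
  obtain ⟨h1', h2', h3'⟩ := h'
  exact continuous_id_iff_le.1 <| @MonoidHom.continuous_of_comp_injective G G X _ τ h2 h1 _ τ'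
    h2' h1' _ _ (MonoidHom.id G) _ h3' Subtype.val_injective h3

theorem isPolishGroupTopology_TOneH_iff (τ : TopologicalSpace TOneH) :
    IsPolishGroupTopology TOneH τ ↔ τ = TOneH.metricTopology :=
  ⟨fun h => le_antisymm (h.le isPolishGroupTopology_metricTopology)
    (isPolishGroupTopology_metricTopology.le h),
    fun h => h ▸ isPolishGroupTopology_metricTopology⟩

/-! ### The dual group and reflexivity -/

/-- For a sequential group the canonical homomorphism into the bidual is continuous. -/
theorem continuous_canonicalHom (X : Type*) [CommGroup X] [TopologicalSpace X]
    [SequentialSpace X] : Continuous (canonicalHom X) := by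
  refine SeqContinuous.continuous fun u x hu => ?_
  -- Restricting characters to a convergent sequence with its limit makes evaluation jointly
  -- continuous, since `OnePoint ℕ` is compact.
  let f : C(OnePoint ℕ, X) := OnePoint.continuousMapMkNat u x hu
  have h : Continuous fun p => canonicalHom X (f p) := by
    refine ContinuousMonoidHom.continuous_of_continuous_uncurry _ ?_
    have h1 : Continuous fun χ : PontryaginDual X =>
        (ContinuousMonoidHom.toContinuousMap χ).comp f :=
      (ContinuousMap.continuous_precomp f).comp
        (ContinuousMonoidHom.isInducing_toContinuousMap X Circle).continuous
    exact continuous_eval.comp ((h1.comp continuous_snd).prodMk continuous_fst)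
  exact (OnePoint.continuous_iff_from_nat _).1 h

theorem norm_one_sub_prod_circle_le {ι : Type*} (x : ι → Circle) (S : Finset ι) :
    ‖(1 : ℂ) - (∏ i ∈ S, x i : Circle)‖ ≤ ∑ i ∈ S, ‖(1 : ℂ) - x i‖ := by
  classical
  induction S using Finset.induction_on with
  | empty => simp
  | insert a S ha ih =>
    rw [Finset.prod_insert ha, Finset.sum_insert ha]
    exact (norm_one_sub_mul_circle_le _ _).trans (by gcongr)

theorem norm_one_sub_div_circle (z w : Circle) :
    ‖(1 : ℂ) - (z / w : Circle)‖ = ‖(z : ℂ) - w‖ := by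
  have : (z : ℂ) - w = -(w * (1 - (z / w : Circle))) := by
    rw [mul_sub, ← Circle.coe_mul, mul_div_cancel]; ring
  rw [this, norm_neg, norm_mul, Circle.norm_coe, one_mul]

theorem norm_zpow_sub_zpow_circle_le (z w : Circle) (k : ℤ) :
    ‖((z ^ k : Circle) : ℂ) - (w ^ k : Circle)‖ ≤ |(k : ℝ)| * ‖(z : ℂ) - w‖ := by
  rw [← norm_one_sub_div_circle, ← norm_one_sub_div_circle z, ← div_zpow]
  exact norm_one_sub_circle_zpow_le _ _

namespace MetricTOneH

theorem exists_tendsto_prod (z : MetricTOneH) :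
    ∃ w : Circle, Tendsto (fun N => ∏ n ∈ Finset.range N, z n) atTop (𝓝 w) := by
  refine cauchySeq_tendsto_of_complete (cauchySeq_of_summable_dist ?_)
  refine z.summable.congr fun N => ?_
  rw [dist_comm, circle_dist_eq_norm, ← norm_one_sub_div_circle, Finset.prod_range_succ,
    mul_div_cancel_left]

/-- The character `z ↦ ∏ z_n`. -/
def prodHom : MetricTOneH →* Circle where
  toFun z := (exists_tendsto_prod z).choose
  map_one' := tendsto_nhds_unique (exists_tendsto_prod 1).choose_spec (by simp)
  map_mul' z w := tendsto_nhds_unique (exists_tendsto_prod (z * w)).choose_spec (by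
    simpa only [mul_apply, Finset.prod_mul_distrib] using
      (exists_tendsto_prod z).choose_spec.mul (exists_tendsto_prod w).choose_spec)

theorem tendsto_prodHom (z : MetricTOneH) :
    Tendsto (fun N => ∏ n ∈ Finset.range N, z n) atTop (𝓝 (prodHom z)) :=
  (exists_tendsto_prod z).choose_spec

theorem norm_one_sub_prodHom_le (z : MetricTOneH) : ‖(1 : ℂ) - prodHom z‖ ≤ dist 1 z := by
  refine le_of_tendsto ((continuous_const.sub continuous_circle_coe).norm.tendsto _ |>.comp
    (tendsto_prodHom z)) (Eventually.of_forall fun N => ?_)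
  exact (norm_one_sub_prod_circle_le _ _).trans (sum_le_dist 1 z N)

theorem continuous_prodHom : Continuous prodHom := by
  refine (LipschitzWith.of_dist_le_mul (K := 1) fun z w => ?_).continuous
  rw [circle_dist_eq_norm, ← norm_one_sub_div_circle, ← map_div, NNReal.coe_one, one_mul]
  refine (norm_one_sub_prodHom_le _).trans_eq ?_
  rw [← dist_mul_left w, mul_one, mul_div_cancel, dist_comm]

/-- Integer sequences bounded by `M`. -/
abbrev BoundedExponents (M : ℕ) : Type := ℕ → Set.Icc (-(M : ℤ)) M

theorem abs_exponent_le {M : ℕ} (k : BoundedExponents M) (n : ℕ) : |((k n : ℤ) : ℝ)| ≤ M := by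
  rw [← Int.cast_abs]
  exact_mod_cast abs_le.2 (k n).2

theorem norm_one_sub_zpow_exponent_le {M : ℕ} (k : BoundedExponents M) (w : Circle) (n : ℕ) :
    ‖(1 : ℂ) - (w ^ (k n : ℤ) : Circle)‖ ≤ M * ‖(1 : ℂ) - w‖ :=
  (norm_one_sub_circle_zpow_le _ _).trans (by gcongr; exact abs_exponent_le k n)

/-- The sequence `(z_n ^ k_n)`. -/
def powSeq {M : ℕ} (k : BoundedExponents M) (z : MetricTOneH) : MetricTOneH :=
  mk (fun n => z n ^ (k n : ℤ)) <| Summable.of_nonneg_of_le (fun _ => norm_nonneg _)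
    (fun n => norm_one_sub_zpow_exponent_le k (z n) n) (z.summable.mul_left (M : ℝ))

@[simp] theorem powSeq_apply {M : ℕ} (k : BoundedExponents M) (z : MetricTOneH) (n : ℕ) :
    powSeq k z n = z n ^ (k n : ℤ) := rfl

theorem dist_powSeq_le {M : ℕ} (k : BoundedExponents M) (z w : MetricTOneH) :
    dist (powSeq k z) (powSeq k w) ≤ M * dist z w := by
  rw [dist_def, dist_def, ← tsum_mul_left]
  refine (summable_sub _ _).tsum_le_tsum (fun n => ?_) ((summable_sub z w).mul_left _)
  exact (norm_zpow_sub_zpow_circle_le _ _ _).trans (by gcongr; exact abs_exponent_le k n)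

/-- Each term depends on one discrete coordinate of `k`, and the series is dominated by `2 M |1 -
w_n|` uniformly in `k`. -/
theorem continuous_dist_powSeq {M : ℕ} (l : BoundedExponents M) (w : MetricTOneH) :
    Continuous fun k : BoundedExponents M => dist (powSeq k w) (powSeq l w) := by
  simp only [dist_def]
  refine continuous_tsum (u := fun n => 2 * (M * ‖(1 : ℂ) - w n‖)) (fun n => ?_)
    ((w.summable.mul_left _).mul_left _) fun n k => ?_
  · exact (continuous_of_discreteTopology (f := fun a : Set.Icc (-(M : ℤ)) M =>
      ‖((w n ^ (a : ℤ) : Circle) : ℂ) - (w n ^ (l n : ℤ) : Circle)‖)).comp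
        (_root_.continuous_apply n)
  · rw [norm_norm, two_mul]
    refine (norm_sub_le_norm_sub_add_norm_sub _ 1 _).trans (add_le_add ?_ ?_)
    · rw [norm_sub_rev]; exact norm_one_sub_zpow_exponent_le k (w n) n
    · exact norm_one_sub_zpow_exponent_le l (w n) n

theorem continuous_powSeq (M : ℕ) :
    Continuous fun p : BoundedExponents M × MetricTOneH => powSeq p.1 p.2 := by
  refine continuous_iff_continuousAt.2 fun ⟨l, w⟩ => tendsto_iff_dist_tendsto_zero.2 ?_
  have h : Tendsto (fun p : BoundedExponents M × MetricTOneH =>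
      M * dist p.2 w + dist (powSeq p.1 w) (powSeq l w)) (𝓝 (l, w)) (𝓝 0) := by
    have : Continuous fun p : BoundedExponents M × MetricTOneH =>
        M * dist p.2 w + dist (powSeq p.1 w) (powSeq l w) :=
      (continuous_const.mul (continuous_snd.dist continuous_const)).add
        ((continuous_dist_powSeq l w).comp continuous_fst)
    simpa using this.tendsto (l, w)
  refine squeeze_zero (fun _ => dist_nonneg) (fun p => ?_) h
  exact (dist_triangle _ (powSeq p.1 w) _).trans (add_le_add_left (dist_powSeq_le _ _ _) _)

/-- The character `z ↦ ∏ z_n ^ k_n` for a bounded sequence `k`. -/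
def boundedChar {M : ℕ} (k : BoundedExponents M) : PontryaginDual MetricTOneH :=
  show MetricTOneH →ₜ* Circle from
  { toFun := fun z => prodHom (powSeq k z)
    map_one' := by
      rw [show powSeq k 1 = 1 from DFunLike.ext _ _ fun n => by simp, map_one]
    map_mul' := fun z w => by
      rw [← map_mul]
      exact congrArg _ (DFunLike.ext _ _ fun n => by simp [mul_zpow])
    continuous_toFun := continuous_prodHom.comp
      ((continuous_powSeq M).comp (continuous_const.prodMk continuous_id)) }

theorem continuous_boundedChar (M : ℕ) :
    Continuous (boundedChar : BoundedExponents M → PontryaginDual MetricTOneH) :=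
  ContinuousMonoidHom.continuous_of_continuous_uncurry _
    (continuous_prodHom.comp (continuous_powSeq M))

theorem tendsto_boundedChar {M : ℕ} (k : BoundedExponents M) (z : MetricTOneH) :
    Tendsto (fun N => ∏ n ∈ Finset.range N, z n ^ (k n : ℤ)) atTop (𝓝 (boundedChar k z)) :=
  tendsto_prodHom (powSeq k z)

/-- The `n`-th coordinate character. -/
def coordChar (n : ℕ) : PontryaginDual MetricTOneH :=
  show MetricTOneH →ₜ* Circle from
  { toFun := fun z => z n
    map_one' := rfl
    map_mul' := fun _ _ => rfl
    continuous_toFun := continuous_apply n }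

@[simp] theorem coordChar_apply (n : ℕ) (z : MetricTOneH) : coordChar n z = z n := rfl

theorem prod_coordChar_apply (S : Finset ℕ) (k : ℕ → ℤ) (z : MetricTOneH) :
    (∏ n ∈ S, coordChar n ^ k n) z = ∏ n ∈ S, z n ^ k n := by
  change canonicalHom MetricTOneH z _ = _
  rw [map_prod]
  exact Finset.prod_congr rfl fun n _ => map_zpow _ _ _

/-- The sequence `k` set to zero outside of `S`. -/
def restrictExponents {M : ℕ} (S : Finset ℕ) (k : BoundedExponents M) : BoundedExponents M :=
  fun n => if n ∈ S then k n else ⟨0, by simp⟩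

theorem boundedChar_restrict {M : ℕ} (S : Finset ℕ) (k : BoundedExponents M) :
    boundedChar (restrictExponents S k) = ∏ n ∈ S, coordChar n ^ (k n : ℤ) := by
  refine PontryaginDual.ext fun z => ?_
  rw [prod_coordChar_apply]
  refine tendsto_nhds_unique (tendsto_boundedChar _ z) (tendsto_const_nhds.congr' ?_)
  obtain ⟨N₀, hN₀⟩ := S.exists_nat_subset_range
  filter_upwards [eventually_ge_atTop N₀] with N hN
  rw [← Finset.prod_subset (hN₀.trans (Finset.range_subset_range.2 hN))]
  · exact Finset.prod_congr rfl fun n hn => by simp [restrictExponents, hn]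
  · intro n _ hn; simp [restrictExponents, hn]

theorem tendsto_restrictExponents {M : ℕ} (k : BoundedExponents M) :
    Tendsto (fun N => restrictExponents (Finset.range N) k) atTop (𝓝 k) := by
  refine tendsto_pi_nhds.2 fun n => tendsto_const_nhds.congr' ?_
  filter_upwards [eventually_gt_atTop n] with N hN
  simp [restrictExponents, hN]

/-- Every continuous character of `MetricTOneH` is given by a bounded integer sequence. -/
theorem exists_eq_boundedChar (χ : PontryaginDual MetricTOneH) :
    ∃ (M : ℕ) (k : BoundedExponents M), χ = boundedChar k := by
  have hχ : Continuous χ := map_continuous χ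
  have hk : ∀ n, ∃ k : ℤ, ∀ w, χ (single n w) = w ^ k := fun n =>
    exists_zpow_of_continuous_circleHom ((χ : MetricTOneH →* Circle).comp (single n))
      (hχ.comp (continuous_single n))
  choose k hk using hk
  obtain ⟨r, hr, hball⟩ : ∃ r > 0, ∀ z, dist z 1 < r → ‖(1 : ℂ) - χ z‖ < 1 :=
    Metric.isOpen_iff.1 (isOpen_lt (continuous_const.sub (continuous_circle_coe.comp hχ)).norm
      continuous_const) 1 (by simp)
  obtain ⟨M, hM⟩ := exists_nat_ge (Real.pi / r)
  have hbd : ∀ n, |k n| ≤ M := by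
    intro n
    by_contra! hlt
    have hlt' : (M : ℝ) < |(k n : ℝ)| := by rw [← Int.cast_abs]; exact_mod_cast hlt
    have hk0 : (0 : ℝ) < |(k n : ℝ)| := (Nat.cast_nonneg M).trans_lt hlt'
    have hk0' : (k n : ℝ) ≠ 0 := abs_pos.1 hk0
    -- If `|k n| > M ≥ π / r`, the point `exp (iπ / k n)` is within `r` of `1`, but `χ` sends it to
    -- `-1`, at distance `2` from `1`.
    have h := hball (single n (Circle.exp (Real.pi / k n))) (by
      rw [dist_comm, ← map_one (single n), dist_single]
      refine (norm_one_sub_circleExp_le _).trans_lt ?_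
      rw [abs_div, abs_of_pos Real.pi_pos, div_lt_iff₀ hk0, mul_comm, ← div_lt_iff₀ hr]
      exact hM.trans_lt hlt')
    rw [hk, ← Circle.exp_zsmul, zsmul_eq_mul, mul_div_cancel₀ _ hk0', Circle.coe_exp,
      Complex.exp_pi_mul_I] at h
    norm_num at h
  refine ⟨M, fun n => ⟨k n, abs_le.1 (hbd n)⟩, PontryaginDual.ext fun z => ?_⟩
  refine tendsto_nhds_unique ((hχ.tendsto z).comp (tendsto_trunc z))
    ((tendsto_boundedChar _ z).congr fun N => ?_)
  rw [Function.comp_apply, trunc_eq_prod, map_prod]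
  simp only [hk]

/-- The signs of the coordinates of `x` as an exponent sequence. -/
def signExponents (x : ℕ → Circle) : BoundedExponents 1 :=
  fun n => ⟨circleSign (x n), abs_le.1 (by simp [abs_circleSign])⟩

theorem canonicalHom_surjective : Function.Surjective (canonicalHom MetricTOneH) := by
  intro ψ
  have hψ : Continuous ψ := map_continuous ψ
  let x : ℕ → Circle := fun n => ψ (coordChar n)
  have hprod : ∀ (S : Finset ℕ) (k : ℕ → ℤ), ψ (∏ n ∈ S, coordChar n ^ k n) =
      ∏ n ∈ S, x n ^ k n := by
    intro S k
    rw [map_prod]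
    exact Finset.prod_congr rfl fun n _ => map_zpow _ _ _
  have hx : Summable fun n => ‖(1 : ℂ) - x n‖ := by
    let k₀ : BoundedExponents 1 := fun _ => ⟨0, by simp⟩
    have hk₀ : boundedChar k₀ = 1 := by
      have := boundedChar_restrict ∅ k₀
      rwa [Finset.prod_empty, show restrictExponents ∅ k₀ = k₀ from
        funext fun n => rfl] at this
    have hc : Continuous fun k : BoundedExponents 1 => ‖(1 : ℂ) - ψ (boundedChar k)‖ :=
      (continuous_const.sub
        (continuous_circle_coe.comp (hψ.comp (continuous_boundedChar 1)))).norm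
    have hmem : {k : BoundedExponents 1 | ‖(1 : ℂ) - ψ (boundedChar k)‖ < 1} ∈ 𝓝 k₀ :=
      (isOpen_lt hc continuous_const).mem_nhds (by simp [hk₀])
    -- A basic neighbourhood of the zero exponents constrains only the coordinates in `I`, so any
    -- signs may be used off `I`.
    rw [nhds_pi, mem_pi'] at hmem
    obtain ⟨I, t, ht, hI⟩ := hmem
    refine summable_norm_one_sub_of_prod_le I fun T hT => ?_
    have h := hI (show restrictExponents T (signExponents x) ∈ _ from fun n hn => by
      have hnT : n ∉ T := fun h => Finset.disjoint_left.1 hT h hn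
      have : restrictExponents T (signExponents x) n = k₀ n := by simp [restrictExponents, hnT, k₀]
      rw [this]
      exact mem_of_mem_nhds (ht n))
    rw [Set.mem_ofPred_eq, boundedChar_restrict, hprod] at h
    exact h.le
  refine ⟨mk x hx, PontryaginDual.ext fun χ => ?_⟩
  obtain ⟨M, k, rfl⟩ := exists_eq_boundedChar χ
  rw [canonicalHom_apply]
  refine tendsto_nhds_unique (tendsto_boundedChar k _) ?_
  refine ((hψ.comp (continuous_boundedChar M)).tendsto k |>.comp
    (tendsto_restrictExponents k)).congr fun N => ?_
  rw [Function.comp_apply, Function.comp_apply, boundedChar_restrict, hprod]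
  rfl

theorem canonicalHom_injective : Function.Injective (canonicalHom MetricTOneH) := fun _ _ h =>
  DFunLike.ext _ _ fun n => DFunLike.congr_fun h (coordChar n)

theorem isInducing_canonicalHom : IsInducing (canonicalHom MetricTOneH) := by
  refine IsTopologicalGroup.isInducing_iff_nhds_one.2 (le_antisymm ?_ ?_)
  · rw [← tendsto_iff_comap, ← map_one (canonicalHom MetricTOneH)]
    exact (continuous_canonicalHom MetricTOneH).tendsto 1
  · intro s hs
    obtain ⟨r, hr, hball⟩ := Metric.mem_nhds_iff.1 hs
    let δ := min 1 (r / 3)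
    have hδ : 0 < δ := by positivity
    let K : Set (PontryaginDual MetricTOneH) := Set.range (boundedChar (M := 1))
    have hK : IsCompact K := isCompact_range (continuous_boundedChar 1)
    let U : Set Circle := {w | ‖(1 : ℂ) - w‖ < δ}
    have hU : IsOpen U :=
      isOpen_lt (continuous_const.sub continuous_circle_coe).norm continuous_const
    let V : Set (PontryaginDual (PontryaginDual MetricTOneH)) := {Ψ | Set.MapsTo Ψ K U}
    have hV : IsOpen V := isOpen_induced (ContinuousMap.isOpen_setOfPred_mapsTo hK hU)
    -- If evaluation at `z` maps `K` into `U`, all signed finite products of `z` are within `δ` of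
    -- `1`, hence `d(1, z) ≤ 2δ < r`.
    refine ⟨V, hV.mem_nhds fun χ _ => by simpa [U] using hδ, fun z hz => hball ?_⟩
    have hsum : ∀ N, ∑ n ∈ Finset.range N, ‖(1 : ℂ) - z n‖ ≤ 2 * δ := fun N =>
      sum_norm_one_sub_le (min_le_left _ _) _ fun T _ => by
        have h : _ ∈ U := hz ⟨restrictExponents T (signExponents z), rfl⟩
        rw [canonicalHom_apply, boundedChar_restrict, prod_coordChar_apply] at h
        exact le_of_lt h
    rw [Metric.mem_ball, dist_comm]
    calc dist 1 z ≤ 2 * δ := dist_le_of_sum_le hsum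
      _ ≤ 2 * (r / 3) := by gcongr; exact min_le_right _ _
      _ < r := by linarith

theorem isReflexiveGroup : IsReflexiveGroup MetricTOneH :=
  isHomeomorph_iff_isEmbedding_surjective.2
    ⟨⟨isInducing_canonicalHom, canonicalHom_injective⟩, canonicalHom_surjective⟩

end MetricTOneH

theorem isReflexiveGroup_TOneH : @IsReflexiveGroup TOneH _ TOneH.metricTopology :=
  MetricTOneH.isReflexiveGroup

/-! ### Characters of `𝕋^∞` and `g`-closedness -/

/-- The character `x ↦ ∏_{n ∈ S} x_n ^ k_n` of `𝕋^∞`. -/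
def monomialChar (S : Finset ℕ) (k : ℕ → ℤ) : PontryaginDual (ℕ → Circle) :=
  show (ℕ → Circle) →ₜ* Circle from
  { toFun := fun x => ∏ n ∈ S, x n ^ k n
    map_one' := by simp
    map_mul' := fun x y => by simp [mul_zpow, Finset.prod_mul_distrib]
    continuous_toFun := continuous_finsetProd _ fun n _ => (continuous_apply n).zpow _ }

theorem monomialChar_apply (S : Finset ℕ) (k : ℕ → ℤ) (x : ℕ → Circle) :
    monomialChar S k x = ∏ n ∈ S, x n ^ k n := rfl

theorem tendsto_circle_one_iff {ι : Type*} {l : Filter ι} {z : ι → Circle} :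
    Tendsto z l (𝓝 1) ↔ Tendsto (fun i => ‖(1 : ℂ) - z i‖) l (𝓝 0) := by
  rw [tendsto_iff_dist_tendsto_zero]
  simp only [dist_comm _ (1 : Circle), circle_dist_eq_norm, Circle.coe_one]

theorem isGClosed_TOneH : IsGClosed TOneH := by
  refine le_antisymm (le_iInf₂ fun _ h => h) fun x hx => ?_
  by_contra hxG
  have hT : ∀ N, ∃ T : Finset ℕ, Disjoint T (Finset.range N) ∧
      1 < ‖(1 : ℂ) - (∏ n ∈ T, x n ^ circleSign (x n) : Circle)‖ := by
    intro N
    by_contra! hall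
    exact hxG (summable_norm_one_sub_of_prod_le (Finset.range N) hall)
  choose T hT hTx using hT
  let u : ℕ → PontryaginDual (ℕ → Circle) := fun N => monomialChar (T N) fun n => circleSign (x n)
  have hu : TOneH ≤ charSubgroup u := by
    intro z hz
    have hz' : Summable fun n => ‖(1 : ℂ) - z n‖ := hz
    refine tendsto_circle_one_iff.2 ?_
    -- As `T N` avoids `range N`, the tail of the series beyond `N` bounds `|1 - u_N(z)|`.
    have hlim := hz'.hasSum.tendsto_sum_nat.const_sub (∑' n, ‖(1 : ℂ) - z n‖)
    rw [sub_self] at hlim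
    refine squeeze_zero (fun _ => norm_nonneg _) (fun N => ?_) hlim
    rw [monomialChar_apply, le_sub_iff_add_le]
    calc _ ≤ ∑ n ∈ T N, ‖(1 : ℂ) - z n‖ + ∑ n ∈ Finset.range N, ‖(1 : ℂ) - z n‖ := by
          gcongr
          refine (norm_one_sub_prod_circle_le _ _).trans (Finset.sum_le_sum fun n _ => ?_)
          refine (norm_one_sub_circle_zpow_le _ _).trans_eq ?_
          rw [← Int.cast_abs, abs_circleSign, Int.cast_one, one_mul]
      _ = ∑ n ∈ T N ∪ Finset.range N, ‖(1 : ℂ) - z n‖ := (Finset.sum_union (hT N)).symm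
      _ ≤ _ := hz'.sum_le_tsum _ fun _ _ => norm_nonneg _
  have hxu : x ∈ charSubgroup u := (Subgroup.mem_iInf.1 (Subgroup.mem_iInf.1 hx u)) hu
  have hlim := tendsto_circle_one_iff.1 hxu
  obtain ⟨N, hN⟩ := (hlim.eventually_lt_const one_pos).exists
  exact (hTx N).not_gt hN

/-- Every continuous character of `𝕋^∞` is a finite monomial. -/
theorem exists_finsupp_eq_prod (χ : PontryaginDual (ℕ → Circle)) :
    ∃ a : ℕ →₀ ℤ, ∀ x, χ x = a.prod fun n k => x n ^ k := by
  have hχ : Continuous χ := map_continuous χ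
  have hk : ∀ n, ∃ k : ℤ, ∀ w, χ (Pi.mulSingle n w) = w ^ k := fun n =>
    exists_zpow_of_continuous_circleHom
      ((χ : (ℕ → Circle) →* Circle).comp (MonoidHom.mulSingle (fun _ => Circle) n))
      (hχ.comp (show Continuous fun w : Circle => (Pi.mulSingle n w : ℕ → Circle) from
        continuous_mulSingle (A := fun _ => Circle) n))
  choose k hk using hk
  -- The subgroup of `x` trivial on `I` lies in a neighbourhood of `1`, so its image under `χ` is a
  -- small subgroup of the circle, hence trivial.
  obtain ⟨I, hI⟩ : ∃ I : Finset ℕ, ∀ x : ℕ → Circle, (∀ n ∈ I, x n = 1) → χ x = 1 := by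
    have hmem : {x | ‖(1 : ℂ) - χ x‖ < 1} ∈ 𝓝 (1 : ℕ → Circle) :=
      (isOpen_lt (continuous_const.sub (continuous_circle_coe.comp hχ)).norm
        continuous_const).mem_nhds (by simp)
    rw [nhds_pi, mem_pi'] at hmem
    obtain ⟨I, t, ht, hI⟩ := hmem
    refine ⟨I, fun x hx => circle_eq_one_of_zpow fun m => ?_⟩
    rw [← map_zpow]
    refine le_of_lt (hI fun n hn => ?_)
    rw [Pi.pow_apply, hx n hn, one_zpow]
    exact mem_of_mem_nhds (ht n)
  have hprod : ∀ x, χ x = ∏ n ∈ I, x n ^ k n := by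
    intro x
    have h1 : χ (x / ∏ n ∈ I, Pi.mulSingle n (x n)) = 1 := by
      refine hI _ fun m hm => ?_
      rw [Pi.div_apply, Finset.prod_apply, Finset.prod_eq_single m]
      · simp
      · intro n _ hn; simp [hn.symm]
      · exact fun h => absurd hm h
    rw [map_div, div_eq_one, map_prod] at h1
    simpa only [hk] using h1
  refine ⟨Finsupp.onFinset I (fun n => if n ∈ I then k n else 0) (by simp +contextual), fun x => ?_⟩
  rw [Finsupp.onFinset_prod _ (fun _ => zpow_zero _), hprod]
  exact Finset.prod_congr rfl fun n hn => by rw [if_pos hn]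

/-! ### Sparse columns and failure of characterization -/

/-- For a matrix whose columns are finitely supported, a sparse sequence of columns with disjoint
supports. -/
theorem exists_strictMono_disjoint_columns {a : ℕ → ℕ →₀ ℤ}
    (ha : ∀ n, ∀ᶠ j in atTop, a j n = 0) {p : ℕ → ℕ → Prop}
    (hmono : ∀ i i' n, i ≤ i' → p i' n → p i n) (hp : ∀ i, ∃ᶠ n in atTop, p i n) :
    ∃ f : ℕ → ℕ, StrictMono f ∧ (∀ i, p i (f i)) ∧
      ∀ j i i', a j (f i) ≠ 0 → a j (f i') ≠ 0 → i = i' := by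
  have hdisj : ∀ n, ∀ᶠ n' in atTop, ∀ j, a j n ≠ 0 → a j n' = 0 := by
    intro n
    have hfin : {j | a j n ≠ 0}.Finite := by
      have := ha n
      rwa [← Nat.cofinite_eq_atTop, eventually_cofinite] at this
    refine (hfin.eventually_all).2 fun j _ => ?_
    rw [← Nat.cofinite_eq_atTop, eventually_cofinite]
    exact (a j).hasFiniteSupport
  -- Build pairs (level, column) with both entries increasing and supports disjoint. The `i`-th
  -- level is at least `i`, so `hmono` brings the property down to level `i`.
  obtain ⟨g, hg1, hg2⟩ := exists_seq_of_forall_finset_exists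
    (fun q : ℕ × ℕ => p q.1 q.2)
    (fun q q' => q.1 < q'.1 ∧ q.2 < q'.2 ∧ ∀ j, a j q.2 ≠ 0 → a j q'.2 = 0) fun s _ => by
      obtain ⟨i, hi⟩ : ∃ i, ∀ q ∈ s, q.1 < i :=
        ((s.eventually_all).2 fun q _ => eventually_gt_atTop q.1).exists
      have h : ∀ᶠ n in atTop, ∀ q ∈ s, q.2 < n ∧ ∀ j, a j q.2 ≠ 0 → a j n = 0 :=
        (s.eventually_all).2 fun q _ => (eventually_gt_atTop q.2).and (hdisj q.2)
      obtain ⟨n, hn, hn'⟩ := ((hp i).and_eventually h).exists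
      exact ⟨(i, n), hn, fun q hq => ⟨hi q hq, hn' q hq⟩⟩
  have hg : StrictMono fun i => (g i).1 := fun i i' h => (hg2 i i' h).1
  refine ⟨fun i => (g i).2, fun i i' h => (hg2 i i' h).2.1,
    fun i => hmono _ _ _ (hg.le_apply) (hg1 i), fun j i i' h h' => ?_⟩
  rcases lt_trichotomy i i' with hlt | heq | hlt
  · exact absurd ((hg2 _ _ hlt).2.2 j h) h'
  · exact heq
  · exact absurd ((hg2 _ _ hlt).2.2 j h') h

theorem finsupp_prod_extend_eq {a : ℕ →₀ ℤ} {f : ℕ → ℕ} (hf : Function.Injective f)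
    (w : ℕ → Circle) {i : ℕ} (hi : ∀ i', a (f i') ≠ 0 → i' = i) :
    (a.prod fun n k => Function.extend f w 1 n ^ k) = w i ^ a (f i) := by
  rw [Finsupp.prod, Finset.prod_eq_single (f i)]
  · rw [hf.extend_apply]
  · intro n hn hne
    by_cases h : ∃ i', f i' = n
    · obtain ⟨i', rfl⟩ := h
      exact absurd (congrArg f (hi i' (Finsupp.mem_support_iff.1 hn))) hne
    · rw [Function.extend_apply' _ _ _ h, Pi.one_apply, one_zpow]
  · intro h
    rw [Finsupp.notMem_support_iff.1 h, zpow_zero]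

theorem extend_mem_TOneH_iff {f : ℕ → ℕ} (hf : Function.Injective f) (w : ℕ → Circle) :
    Function.extend f w 1 ∈ TOneH ↔ Summable fun i => ‖(1 : ℂ) - w i‖ := by
  have h := hf.summable_iff (f := fun n => ‖(1 : ℂ) - (Function.extend f w 1 n : Circle)‖)
    fun n hn => by simp [Function.extend_apply' _ _ _ (Set.mem_range.not.1 hn)]
  refine Iff.trans h.symm (iff_of_eq (congrArg Summable (funext fun i => ?_)))
  rw [Function.comp_apply, hf.extend_apply]

/-- The exponents of a sequence of characters converging to `1` on `TOneH` are bounded. -/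
theorem exists_bound_exponents {a : ℕ → ℕ →₀ ℤ} (ha : ∀ n, ∀ᶠ j in atTop, a j n = 0)
    (h : ∀ x ∈ TOneH, Tendsto (fun j => (a j).prod fun n k => x n ^ k) atTop (𝓝 1)) :
    ∃ M : ℕ, ∀ j n, |a j n| ≤ M := by
  by_contra! hM
  have hcol : ∀ n, ∃ B : ℕ, ∀ j, |a j n| ≤ B := by
    intro n
    obtain ⟨J, hJ⟩ := eventually_atTop.1 (ha n)
    refine ⟨∑ j ∈ Finset.range J, (a j n).natAbs, fun j => ?_⟩
    rcases lt_or_ge j J with hj | hj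
    · rw [Int.abs_eq_natAbs]
      exact_mod_cast Finset.single_le_sum (f := fun j => (a j n).natAbs)
        (fun _ _ => Nat.zero_le _) (Finset.mem_range.2 hj)
    · rw [hJ j hj, abs_zero]; positivity
  choose B hB using hcol
  obtain ⟨f, hf, hfp, hdisj⟩ := exists_strictMono_disjoint_columns ha
    (p := fun i n => ∃ j, 2 ^ i ≤ |a j n|)
    (fun i i' n hi ⟨j, hj⟩ => ⟨j, (pow_le_pow_right₀ one_le_two hi).trans hj⟩) fun i hev => by
      obtain ⟨N, hN⟩ := eventually_atTop.1 hev
      -- The threshold exceeds every bound for the first `N` columns, so the large entry lies in a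
      -- column `n ≥ N`.
      obtain ⟨j, n, hjn⟩ := hM (2 ^ i + ∑ n ∈ Finset.range N, B n)
      push_cast at hjn
      have h0 : (0 : ℤ) ≤ ∑ n ∈ Finset.range N, (B n : ℤ) := by positivity
      rcases lt_or_ge n N with hn | hn
      · have h1 := Finset.single_le_sum (f := fun n => (B n : ℤ)) (fun _ _ => by positivity)
          (Finset.mem_range.2 hn)
        have h2 := hB n j
        have h3 : (0 : ℤ) < 2 ^ i := by positivity
        linarith
      · exact hN n hn ⟨j, by linarith⟩
  choose J hJ using hfp
  have hne : ∀ i, a (J i) (f i) ≠ 0 := fun i h0 => by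
    have := hJ i
    rw [h0, abs_zero] at this
    exact absurd this (not_le.2 (by positivity))
  have hJinj : Function.Injective J := fun i i' hii => hdisj (J i) i i' (hne i) (hii ▸ hne i')
  -- Row `J i` meets only column `f i` among those chosen, so its character takes the value `exp
  -- (iπ) = -1`, while `|1 - w i| ≤ π / 2 ^ i` is summable.
  let w : ℕ → Circle := fun i => Circle.exp (Real.pi / a (J i) (f i))
  have hw : Summable fun i => ‖(1 : ℂ) - w i‖ := by
    refine Summable.of_nonneg_of_le (fun _ => norm_nonneg _) (fun i => ?_)
      ((summable_geometric_two).mul_left Real.pi)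
    refine (norm_one_sub_circleExp_le _).trans ?_
    have hJ' : (2 : ℝ) ^ i ≤ |(a (J i) (f i) : ℝ)| := by
      rw [← Int.cast_abs]; exact_mod_cast hJ i
    rw [abs_div, abs_of_pos Real.pi_pos, div_eq_mul_inv, one_div, inv_pow]
    gcongr
  have hlim := (h _ ((extend_mem_TOneH_iff hf.injective w).2 hw)).comp
    (hJinj.nat_tendsto_atTop)
  have hval : ∀ i, ((a (J i)).prod fun n k => Function.extend f w 1 n ^ k) = Circle.exp Real.pi := by
    intro i
    have h0 : (a (J i) (f i) : ℝ) ≠ 0 := Int.cast_ne_zero.2 (hne i)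
    rw [finsupp_prod_extend_eq hf.injective w fun i' hi' => hdisj (J i) i' i hi' (hne i),
      ← Circle.exp_zsmul, zsmul_eq_mul, mul_div_cancel₀ _ h0]
  exact Circle.exp_pi_ne_one
    (tendsto_nhds_unique (tendsto_const_nhds.congr fun i => (hval i).symm) hlim)

theorem not_isCharacterized_TOneH : ¬ IsCharacterized TOneH := by
  rintro ⟨u, hu⟩
  choose a ha using fun j => exists_finsupp_eq_prod (u j)
  have hmem : ∀ x : ℕ → Circle, x ∈ TOneH ↔
      Tendsto (fun j => (a j).prod fun n k => x n ^ k) atTop (𝓝 1) := by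
    intro x
    simp only [← ha]
    rw [hu]
    rfl
  have hcol : ∀ n, ∀ᶠ j in atTop, a j n = 0 := by
    refine fun n => eventually_eq_zero_of_tendsto_zpow fun z => ?_
    have hz : (Pi.mulSingle n z : ℕ → Circle) ∈ TOneH := (MetricTOneH.single n z).summable
    refine ((hmem _).1 hz).congr fun j => ?_
    rw [Finsupp.prod, Finset.prod_eq_single n]
    · simp
    · intro m _ hm; simp [hm]
    · intro h; rw [Finsupp.notMem_support_iff.1 h, zpow_zero]
  obtain ⟨M, hM⟩ := exists_bound_exponents hcol fun x hx => (hmem x).1 hx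
  obtain ⟨f, hf, -, hdisj⟩ := exists_strictMono_disjoint_columns hcol (p := fun _ _ => True)
    (fun _ _ _ _ h => h) (fun _ => Frequently.of_forall fun _ => trivial)
  -- Harmonic angles: `w i → 1`, but `∑ |1 - w i|` diverges.
  let w : ℕ → Circle := fun i => Circle.exp (1 / ((i : ℝ) + 1))
  have hw : ∀ i, ‖(1 : ℂ) - w i‖ ≤ 1 / ((i : ℝ) + 1) := fun i =>
    (norm_one_sub_circleExp_le _).trans_eq (abs_of_nonneg (by positivity))
  have hns : Function.extend f w 1 ∉ TOneH := by
    rw [extend_mem_TOneH_iff hf.injective]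
    intro hs
    have h1 : Summable fun i : ℕ => 2 / Real.pi * (1 / ((i : ℝ) + 1)) := by
      refine Summable.of_nonneg_of_le (fun i => by positivity) (fun i => ?_) hs
      refine two_div_pi_mul_le_norm_one_sub_circleExp (by positivity) ?_
      have : 1 / ((i : ℝ) + 1) ≤ 1 := by
        rw [div_le_one (by positivity)]; linarith [Nat.cast_nonneg (α := ℝ) i]
      linarith [Real.pi_gt_three]
    rw [summable_mul_left_iff (by positivity)] at h1
    refine Real.not_summable_one_div_natCast ((summable_nat_add_iff 1).1 ?_)
    exact_mod_cast h1
  refine hns ((hmem _).2 (tendsto_circle_one_iff.2 (Metric.tendsto_atTop'.2 fun ε hε => ?_)))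
  -- Late rows vanish on the first `I` chosen columns, so the single entry they may meet contributes
  -- at most `M / (i + 1) < ε`.
  obtain ⟨I, hI⟩ := exists_nat_gt (M / ε)
  obtain ⟨N, hN⟩ := eventually_atTop.1
    (((Finset.range I).eventually_all).2 fun i _ => hcol (f i))
  refine ⟨N, fun j hj => ?_⟩
  rw [dist_zero_right, norm_norm]
  by_cases hex : ∃ i, a j (f i) ≠ 0
  · obtain ⟨i, hi⟩ := hex
    have hIi : I ≤ i := by
      by_contra! hlt
      exact hi (hN j hj.le i (Finset.mem_range.2 hlt))
    have hIi' : (I : ℝ) ≤ i := by exact_mod_cast hIi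
    rw [finsupp_prod_extend_eq hf.injective w fun i' hi' => hdisj j i' i hi' hi]
    calc _ ≤ |(a j (f i) : ℝ)| * ‖(1 : ℂ) - w i‖ := norm_one_sub_circle_zpow_le _ _
      _ ≤ M * (1 / ((i : ℝ) + 1)) := by
        gcongr
        · rw [← Int.cast_abs]; exact_mod_cast hM j (f i)
        · exact hw i
      _ < ε := by
        rw [mul_one_div, div_lt_iff₀ (by positivity)]
        rw [div_lt_iff₀ hε] at hI
        nlinarith
  · push Not at hex
    -- The row misses all chosen columns; the index `0` is arbitrary.
    rw [finsupp_prod_extend_eq hf.injective w (i := 0) fun i' hi' => absurd (hex i') hi', hex,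
      zpow_zero]
    simpa using hε

end

theorem mainTheorem9 :
    IsSigmaCompact (TOneH : Set (ℕ → Circle)) ∧
    IsPolishable TOneH ∧
    (∀ τ : TopologicalSpace TOneH,
      IsPolishGroupTopology TOneH τ ↔ τ = TOneH.metricTopology) ∧
    @IsReflexiveGroup TOneH _ TOneH.metricTopology ∧
    IsGClosed TOneH ∧
    ¬ IsCharacterized TOneH :=
  ⟨isSigmaCompact_TOneH,
    ⟨measurableSet_TOneH, TOneH.metricTopology, isPolishGroupTopology_metricTopology⟩,
    isPolishGroupTopology_TOneH_iff, isReflexiveGroup_TOneH, isGClosed_TOneH,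
    not_isCharacterized_TOneH⟩
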